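/- Let $G=\mathrm{PSL}_2(\mathbb Z)$ with the elements $a,b$ given by the matrices $\left(\begin{smallmatrix}0&-1\\1&0\end{smallmatrix}\right)$ and $\left(\begin{smallmatrix}0&-1\\1&1\end{smallmatrix}\right)$; then $G$ has the presentation $\langle a,b\mid a^2=1,\ b^3=1\rangle$, i.e. the canonical homomorphism from the group so presented to $G$ is an isomorphism. Let $\Gamma$ be the Cayley graph of $G$ with respect to $a,b$, in which $a$ gives double edges, so that $\Gamma$ is $4$-regular, and let $\mathcal L$ be its normalized Laplacian, the bounded operator on $\ell^2(G)$ given by $$(\mathcal L f)(x)=f(x)-\tfrac12 f(xa)-\tfrac14 f(xb)-\tfrac14 f(xb^{-1}).$$ For $t\ge 0$ let $h_t=e^{-t\mathcal L}$ be the heat kernel, and let $k_t\colon G\to\mathbb R$ be the function determined by $(h_tf)(x)=\sum_{y\in G}k_t(y^{-1}x)f(y)$ for all $f\in\ell^2(G)$ and $x\in G$. Let $|x|$ be the shortest length of a word in $a,b,b^{-1}$ representing $x$, and let $\pi\colon G\to\mathbb Z$ be the signed word length: $\pi(e)=0$; $\pi(x)=|x|$ if the reduced form of $x$ (the word representing $x$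 in which letters $a$ and letters $b^{\pm1}$ alternate) starts with $b$ or $b^{-1}$; and $\pi(x)=-|x|$ if it starts with $a$. Then, for every $t\ge0$, a function $k_t$ as above exists, is unique, and is given by $k_t(x)=K_t(\pi(x))$, where for $n\in\mathbb Z$ $$K_t(n)=e^{-3t/4}\alpha_n+e^{-7t/4}\beta_n+\int_0^\pi e^{-t\left(\frac78-\frac{R_s}2\right)}\gamma_n^-(s)\,ds+\int_0^\pi e^{-t\left(\frac78+\frac{R_s}2\right)}\gamma_n^+(s)\,ds,\qquad R_s=\sqrt{\tfrac{25}{16}+\sqrt2\cos s},$$ with the following coefficients; in the formulas for $\gamma_n^\pm$ the first line is for even $n=2m$ and the second line for odd $n=2m+1$. For $n\ge0$: $$\alpha_n=\frac{(-1)^{\lceil n/2\rceil}2^{-\lceil n/2\rceil}}6,\qquad \beta_n=\frac{(-1)^n2^{-\lceil n/2\rceil}}6,$$ $$\gamma_n^\pm(s)=\frac{\sqrt2^{\,-\lceil n/2\rceil}\sin s}{\pi R_s(1+8\sin^2 s)}\begin{cases}\mp(\sqrt2+\cos s)\sin(ms)+4R_s\sin s\cos(ms)\\ \pm(4+2\sqrt2\cos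 s)\sin(ms)+\left(\sqrt2R_s\mp\left(\tfrac{9\sqrt2}4+4\cos s\right)\right)\sin((m+1)s).\end{cases}$$ For $n<0$: $$\alpha_n=\frac{(-1)^{\lceil n/2\rceil}2^{\lceil n/2\rceil}}6,\qquad \beta_n=\frac{(-1)^n2^{\lceil n/2\rceil}}6,$$ $$\gamma_n^\pm(s)=\frac{\sqrt2^{\,\lceil n/2\rceil}\sin s}{\pi R_s(1+8\sin^2 s)}\begin{cases}\pm(\sqrt2+\cos s)\sin(ms)+4R_s\sin s\cos(ms)\\ \pm(4+2\sqrt2\cos s)\sin(ms)-\left(\sqrt2R_s\pm\left(\tfrac{9\sqrt2}4+4\cos s\right)\right)\sin((m+1)s).\end{cases}$$ -/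

import Mathlib

open scoped Matrix MatrixGroups ENNReal

noncomputable section

namespace PSLHeat

/-! ### The modular group, its generators and its presentation -/

/-- The matrix `a = (0 -1; 1 0)`. -/
def matA : SL(2, ℤ) := ⟨!![0, -1; 1, 0], by simp [Matrix.det_fin_two]⟩

/-- The matrix `b = (0 -1; 1 1)`. -/
def matB : SL(2, ℤ) := ⟨!![0, -1; 1, 1], by simp [Matrix.det_fin_two]⟩

/-- The class of `matA` in `PSL(2, ℤ)`. -/
def genA : PSL(2, ℤ) := QuotientGroup.mk matA

/-- The class of `matB` in `PSL(2, ℤ)`. -/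
def genB : PSL(2, ℤ) := QuotientGroup.mk matB

lemma neg_one_mem_center : (-1 : SL(2, ℤ)) ∈ Subgroup.center SL(2, ℤ) := by
  rw [Subgroup.mem_center_iff]
  intro g
  simp

lemma genA_sq : genA ^ 2 = 1 := by
  have h : matA ^ 2 = -1 := by
    apply Subtype.ext
    rw [Matrix.SpecialLinearGroup.coe_pow]
    ext i j
    fin_cases i <;> fin_cases j <;> simp [matA, pow_two]
  have h2 : genA ^ 2 = QuotientGroup.mk (matA ^ 2) := rfl
  rw [h2, h, QuotientGroup.eq_one_iff]
  exact neg_one_mem_center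

lemma genB_cube : genB ^ 3 = 1 := by
  have h : matB ^ 3 = -1 := by
    apply Subtype.ext
    rw [Matrix.SpecialLinearGroup.coe_pow]
    ext i j
    fin_cases i <;> fin_cases j <;> simp [matB, pow_succ]
  have h2 : genB ^ 3 = QuotientGroup.mk (matB ^ 3) := rfl
  rw [h2, h, QuotientGroup.eq_one_iff]
  exact neg_one_mem_center

/-- The two abstract generators of the presentation. -/
inductive Gen
  | a
  | b

/-- The relators `a²` and `b³`. -/
def relators : Set (FreeGroup Gen) := {FreeGroup.of Gen.a ^ 2, FreeGroup.of Gen.b ^ 3}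

/-- The images in `PSL(2, ℤ)` of the two abstract generators. -/
def genMap : Gen → PSL(2, ℤ)
  | Gen.a => genA
  | Gen.b => genB

lemma lift_relators : ∀ r ∈ relators, FreeGroup.lift genMap r = 1 := by
  rintro r (rfl | rfl)
  · simpa [genMap] using genA_sq
  · simpa [genMap] using genB_cube

/-- The canonical homomorphism `⟨a, b | a² = 1, b³ = 1⟩ → PSL(2, ℤ)`. -/
def presentationHom : PresentedGroup relators →* PSL(2, ℤ) :=
  PresentedGroup.toGroup lift_relators

/-! ### Words, word length and the projection to `ℤ` -/

/-- The letters `a`, `b` and `b⁻¹`. -/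
inductive Letter
  | a
  | b
  | bInv

/-- Whether a letter is `a` (as opposed to `b` or `b⁻¹`). -/
def Letter.isA : Letter → Bool
  | Letter.a => true
  | Letter.b => false
  | Letter.bInv => false

/-- A word is reduced if letters `a` and letters `b`, `b⁻¹` alternate in it. -/
def IsReduced (w : List Letter) : Prop := w.IsChain (fun l l' => l.isA ≠ l'.isA)

section Cayley

variable {G : Type*} [Group G]

/-- The value of a letter in a group with chosen elements `a` and `b`. -/
def letterVal (a b : G) : Letter → G
  | Letter.a => a
  | Letter.b => b
  | Letter.bInv => b⁻¹

/-- The value of a word, read from left to right. -/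
def wordVal (a b : G) (w : List Letter) : G := (w.map (letterVal a b)).prod

/-- The shortest length of a word in `a`, `b`, `b⁻¹` that represents `x`. -/
def wordLength (a b : G) (x : G) : ℕ :=
  sInf {n : ℕ | ∃ w : List Letter, w.length = n ∧ wordVal a b w = x}

/-- The reduced form of `x` starts with one of the letters `b`, `b⁻¹`. -/
def StartsWithB (a b : G) (x : G) : Prop :=
  ∃ (l : Letter) (w : List Letter),
    l.isA = false ∧ IsReduced (l :: w) ∧ wordVal a b (l :: w) = x

open Classical in
/-- The signed word length: `0` at the identity, `|x|` if the reduced form of `x` starts with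
`b` or `b⁻¹`, and `-|x|` if it starts with `a`. -/
def proj (a b : G) (x : G) : ℤ :=
  if x = 1 then 0
  else if StartsWithB a b x then (wordLength a b x : ℤ)
  else -(wordLength a b x : ℤ)

/-! ### The Cayley graph and its normalized Laplacian -/

open Classical in
/-- The number of edges joining `x` and `y` in the Cayley graph with generators `a` (which gives
double edges) and `b`. -/
def edgeWeight (a b : G) (x y : G) : ℝ :=
  2 * (if y = x * a then 1 else 0) + (if y = x * b then 1 else 0) + (if y = x * b⁻¹ then 1 else 0)

/-- The degree of a vertex. -/
def degree (a b : G) (x : G) : ℝ := ∑' y, edgeWeight a b x y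

open Classical in
/-- The matrix coefficients `δ(x, y) - w(x, y) / √(d(x) d(y))` of the normalized Laplacian. -/
def normalizedCoeff (a b : G) (x y : G) : ℝ :=
  (if x = y then 1 else 0) - edgeWeight a b x y / √(degree a b x * degree a b y)

/-- The complex Hilbert space `ℓ²(G)`. -/
abbrev L2 (G : Type*) : Type _ := lp (fun _ : G => ℂ) 2

lemma memLp_shift (g : G) (f : L2 G) : Memℓp (fun x => f (x * g)) 2 := by
  have h := lp.memℓp f
  rw [memℓp_gen_iff (by norm_num)] at h ⊢
  exact h.comp_injective (i := fun x => x * g) (mul_left_injective g)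

/-- Right translation `(ρ_g f)(x) = f(x g)`, an isometry of `ℓ²(G)`. -/
def shift (g : G) : L2 G →ₗᵢ[ℂ] L2 G where
  toFun f := ⟨fun x => f (x * g), memLp_shift g f⟩
  map_add' f₁ f₂ := by ext x; rfl
  map_smul' c f := by ext x; rfl
  norm_map' f := by
    have hp : 0 < (2 : ℝ≥0∞).toReal := by norm_num
    rw [lp.norm_eq_tsum_rpow hp, lp.norm_eq_tsum_rpow hp]
    congr 1
    exact (Equiv.mulRight g).tsum_eq (fun x => ‖f x‖ ^ (2 : ℝ≥0∞).toReal)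

/-- The normalized Laplacian of the Cayley graph, as a bounded operator on `ℓ²(G)`. -/
def laplacian (a b : G) : L2 G →L[ℂ] L2 G :=
  ContinuousLinearMap.id ℂ (L2 G)
    - (1 / 2 : ℂ) • (shift a).toContinuousLinearMap
    - (1 / 4 : ℂ) • (shift b).toContinuousLinearMap
    - (1 / 4 : ℂ) • (shift b⁻¹).toContinuousLinearMap

lemma laplacian_apply (a b : G) (f : L2 G) (x : G) :
    laplacian a b f x
      = f x - (1 / 2) * f (x * a) - (1 / 4) * f (x * b) - (1 / 4) * f (x * b⁻¹) := rfl

lemma hasSum_edgeWeight (a b x : G) : HasSum (edgeWeight a b x) 4 := by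
  classical
  have h := (((hasSum_ite_eq (x * a) (1 : ℝ)).mul_left 2).add
    (hasSum_ite_eq (x * b) (1 : ℝ))).add (hasSum_ite_eq (x * b⁻¹) (1 : ℝ))
  have e : (2 * 1 + 1 + 1 : ℝ) = 4 := by norm_num
  rw [e] at h
  refine Eq.mpr (congrArg (fun g => HasSum g _) (funext fun y => ?_)) h
  simp only [edgeWeight]

/-- The operator `laplacian` has the matrix coefficients of the normalized Laplacian. -/
lemma laplacian_hasSum (a b : G) (f : L2 G) (x : G) :
    HasSum (fun y => (normalizedCoeff a b x y : ℂ) * f y) (laplacian a b f x) := by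
  classical
  have hd : ∀ z : G, degree a b z = 4 := fun z => (hasSum_edgeWeight a b z).tsum_eq
  have hs : ∀ z : G, HasSum (fun y => if y = z then f z else 0) (f z) :=
    fun z => hasSum_ite_eq z (f z)
  have h := (((hs x).sub ((hs (x * a)).mul_left (1 / 2))).sub
    ((hs (x * b)).mul_left (1 / 4))).sub ((hs (x * b⁻¹)).mul_left (1 / 4))
  rw [laplacian_apply]
  refine Eq.mpr (congrArg (fun g => HasSum g _) (funext fun y => ?_)) h
  have h4 : √((4 : ℝ) * 4) = 4 := Real.sqrt_mul_self (by norm_num)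
  have e : ∀ z : G, (if y = z then f z else 0) = (if y = z then (1 : ℂ) else 0) * f y := by
    intro z
    by_cases hz : y = z
    · simp [hz]
    · simp [hz]
  rw [e, e, e, e]
  simp only [normalizedCoeff, edgeWeight, hd, h4, eq_comm (a := x) (b := y)]
  push_cast
  simp only [apply_ite Complex.ofReal, Complex.ofReal_one, Complex.ofReal_zero]
  ring

/-- The heat kernel `h_t = e^{-tℒ}`, as a bounded operator on `ℓ²(G)`. -/
def heatKernel (a b : G) (t : ℝ) : L2 G →L[ℂ] L2 G :=
  NormedSpace.exp ((-t : ℂ) • laplacian a b)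

end Cayley

/-! ### The explicit coefficients -/

/-- `R_s = √(25/16 + √2 cos s)`. -/
def R (s : ℝ) : ℝ := √(25 / 16 + √2 * Real.cos s)

/-- `⌈n/2⌉`. -/
def halfCeil (n : ℤ) : ℤ := ⌈(n : ℚ) / 2⌉

/-- The coefficient of `e^{-3t/4}`. -/
def alpha (n : ℤ) : ℝ :=
  if 0 ≤ n then (-1) ^ halfCeil n * 2 ^ (-halfCeil n) / 6
  else (-1) ^ halfCeil n * 2 ^ halfCeil n / 6

/-- The coefficient of `e^{-7t/4}`. -/
def beta (n : ℤ) : ℝ :=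
  if 0 ≤ n then (-1) ^ n * 2 ^ (-halfCeil n) / 6
  else (-1) ^ n * 2 ^ halfCeil n / 6

/-- The coefficient `γ_n^+(s)`. Here `n = 2m` or `n = 2m + 1`, that is, `m = ⌊n/2⌋`. -/
def gammaPlus (n : ℤ) (s : ℝ) : ℝ :=
  let m : ℝ := ((n / 2 : ℤ) : ℝ)
  if 0 ≤ n then
    √2 ^ (-halfCeil n) * Real.sin s / (Real.pi * R s * (1 + 8 * Real.sin s ^ 2)) *
      (if Even n then
        -(√2 + Real.cos s) * Real.sin (m * s) + 4 * R s * Real.sin s * Real.cos (m * s)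
      else
        (4 + 2 * √2 * Real.cos s) * Real.sin (m * s)
          + (√2 * R s - (9 * √2 / 4 + 4 * Real.cos s)) * Real.sin ((m + 1) * s))
  else
    √2 ^ halfCeil n * Real.sin s / (Real.pi * R s * (1 + 8 * Real.sin s ^ 2)) *
      (if Even n then
        (√2 + Real.cos s) * Real.sin (m * s) + 4 * R s * Real.sin s * Real.cos (m * s)
      else
        (4 + 2 * √2 * Real.cos s) * Real.sin (m * s)
          - (√2 * R s + (9 * √2 / 4 + 4 * Real.cos s)) * Real.sin ((m + 1) * s))

/-- The coefficient `γ_n^-(s)`. Here `n = 2m` or `n = 2m + 1`, that is, `m = ⌊n/2⌋`. -/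
def gammaMinus (n : ℤ) (s : ℝ) : ℝ :=
  let m : ℝ := ((n / 2 : ℤ) : ℝ)
  if 0 ≤ n then
    √2 ^ (-halfCeil n) * Real.sin s / (Real.pi * R s * (1 + 8 * Real.sin s ^ 2)) *
      (if Even n then
        (√2 + Real.cos s) * Real.sin (m * s) + 4 * R s * Real.sin s * Real.cos (m * s)
      else
        -(4 + 2 * √2 * Real.cos s) * Real.sin (m * s)
          + (√2 * R s + (9 * √2 / 4 + 4 * Real.cos s)) * Real.sin ((m + 1) * s))
  else
    √2 ^ halfCeil n * Real.sin s / (Real.pi * R s * (1 + 8 * Real.sin s ^ 2)) *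
      (if Even n then
        -(√2 + Real.cos s) * Real.sin (m * s) + 4 * R s * Real.sin s * Real.cos (m * s)
      else
        -(4 + 2 * √2 * Real.cos s) * Real.sin (m * s)
          - (√2 * R s - (9 * √2 / 4 + 4 * Real.cos s)) * Real.sin ((m + 1) * s))

/-- The explicit function `K_t(n)`. -/
def K (t : ℝ) (n : ℤ) : ℝ :=
  Real.exp (-t * (3 / 4)) * alpha n + Real.exp (-t * (7 / 4)) * beta n
    + (∫ s in (0 : ℝ)..Real.pi, Real.exp (-t * (7 / 8 - R s / 2)) * gammaMinus n s)
    + (∫ s in (0 : ℝ)..Real.pi, Real.exp (-t * (7 / 8 + R s / 2)) * gammaPlus n s)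

end PSLHeat

end

/-!
The presentation and the formula for the heat kernel both rest on reduced words. In a group with
`a² = b³ = 1` every word can be reduced without becoming longer, and if no nonempty reduced word
represents `1`, then reduced forms are unique. In `PSL(2, ℤ)` the latter hypothesis holds by
ping-pong on integer vectors (`exists_vector_of_isReduced`), and words reach every element because
`SL(2, ℤ)` is generated by `S` and `T`. Hence the presentation, and the signed word length can be
read off from the reduced form (`proj_wordVal`).

The Laplacian `ℒ` maps functions of the signed word length to such functions; `intLaplacian` is the
induced operator on functions on `ℤ` (`intLaplacian_proj`). Its eigenfunctions include `alpha`
(eigenvalue `3/4`), `beta` (eigenvalue `7/4`) and, for every `s`, `gammaMinus · s` and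
`gammaPlus · s` (eigenvalues `7/8 ∓ R s / 2`); the last two are one computation with the two square
roots `∓ R s` of `25/16 + √2 cos s`. The superposition of them in `K 0` is the indicator of `0`
(`moment_zero`): adding `gammaMinus` and `gammaPlus` removes the square root and leaves cosine
integrals against the Poisson kernel `3 / (5 - 4 cos 2s)`.

Therefore `ℒ^k` sends the unit mass at `1` to the function `moment k ∘ proj`, where in `moment k`
the eigenfunctions are weighted by the `k`-th powers of their eigenvalues. Summing the exponential
series gives `e^{-tℒ} δ = K t ∘ proj`. Since `e^{-tℒ}` commutes with left translations, it is
convolution with this function, and no other function represents it, as one sees by applying it to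
the unit mass.
-/

namespace PSLHeat

/-! ### Reduced words in groups generated by an involution and an element of order three -/

section Words

variable {G : Type*} [Group G] {a b : G}

@[simp]
lemma wordVal_nil (a b : G) : wordVal a b [] = 1 := rfl

@[simp]
lemma wordVal_cons (a b : G) (l : Letter) (w : List Letter) :
    wordVal a b (l :: w) = letterVal a b l * wordVal a b w := by
  simp [wordVal]

@[simp]
lemma wordVal_append (a b : G) (u w : List Letter) :
    wordVal a b (u ++ w) = wordVal a b u * wordVal a b w := by
  simp [wordVal]

lemma map_wordVal {H : Type*} [Group H] (φ : G →* H) (a b : G) (w : List Letter) :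
    φ (wordVal a b w) = wordVal (φ a) (φ b) w := by
  induction w with
  | nil => simp
  | cons l w ih => cases l <;> simp [letterVal, ih]

/-- The letter that represents the inverse; `a` is its own inverse since `a² = 1`. -/
def Letter.inv : Letter → Letter
  | Letter.a => Letter.a
  | Letter.b => Letter.bInv
  | Letter.bInv => Letter.b

@[simp]
lemma Letter.isA_inv (l : Letter) : l.inv.isA = l.isA := by
  cases l <;> rfl

/-- The formal inverse of a word. -/
def invWord (w : List Letter) : List Letter := (w.map Letter.inv).reverse

lemma letterVal_inv (ha : a ^ 2 = 1) (l : Letter) :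
    letterVal a b l.inv = (letterVal a b l)⁻¹ := by
  cases l
  · exact eq_inv_of_mul_eq_one_left (by simpa [letterVal, Letter.inv, pow_two] using ha)
  · rfl
  · simp [letterVal, Letter.inv]

lemma wordVal_invWord (ha : a ^ 2 = 1) (w : List Letter) :
    wordVal a b (invWord w) = (wordVal a b w)⁻¹ := by
  induction w with
  | nil => simp [invWord]
  | cons l w ih =>
    have h : invWord (l :: w) = invWord w ++ [l.inv] := by simp [invWord]
    rw [h, wordVal_append, ih]
    simp [letterVal_inv ha]

lemma IsReduced.invWord {w : List Letter} (hw : IsReduced w) : IsReduced (invWord w) := by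
  unfold IsReduced PSLHeat.invWord at *
  rw [List.isChain_reverse, List.isChain_map]
  simpa [eq_comm] using hw

lemma isReduced_cons_cons {l l' : Letter} {w : List Letter} :
    IsReduced (l :: l' :: w) ↔ l.isA ≠ l'.isA ∧ IsReduced (l' :: w) :=
  List.isChain_cons_cons

lemma IsReduced.tail {l : Letter} {w : List Letter} (h : IsReduced (l :: w)) : IsReduced w :=
  List.IsChain.tail h

lemma isReduced_singleton (l : Letter) : IsReduced [l] := List.isChain_singleton _

/-- Replacing the first letter by a letter of the same type preserves reducedness. -/
lemma IsReduced.replace_head {l l' : Letter} {w : List Letter} (h : IsReduced (l :: w))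
    (hl : l'.isA = l.isA) : IsReduced (l' :: w) := by
  cases w with
  | nil => exact isReduced_singleton l'
  | cons c w =>
    rw [isReduced_cons_cons] at h ⊢
    rwa [hl]

/-- Joining `u⁻¹`, a middle letter and `w` gives a reduced word if the middle letter alternates with
the first letters of `u` and `w`. -/
lemma isReduced_invWord_append {l : Letter} {u w : List Letter} (hu : IsReduced (l :: u))
    (hw : IsReduced (l :: w)) : IsReduced (invWord u ++ l :: w) := by
  have h := hu.invWord
  unfold IsReduced at *
  have e : invWord (l :: u) = invWord u ++ [l.inv] := by simp [invWord]
  rw [e, List.isChain_append] at h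
  rw [List.isChain_append]
  refine ⟨h.1, hw, fun x hx y hy => ?_⟩
  obtain rfl : l = y := by simpa using hy
  simpa using h.2.2 x hx l.inv (by simp)

lemma inv_eq_mul_self (hb : b ^ 3 = 1) : b⁻¹ = b * b :=
  inv_eq_of_mul_eq_one_left (by rw [← hb, pow_succ, pow_two])

lemma inv_mul_inv (hb : b ^ 3 = 1) : b⁻¹ * b⁻¹ = b := by
  rw [inv_eq_mul_self hb]
  rw [← mul_assoc, ← pow_two, ← pow_succ, hb, one_mul]

/-- Every word can be reduced without becoming longer. -/
lemma exists_isReduced (ha : a ^ 2 = 1) (hb : b ^ 3 = 1) (w : List Letter) :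
    ∃ w', IsReduced w' ∧ w'.length ≤ w.length ∧ wordVal a b w' = wordVal a b w := by
  induction w with
  | nil => exact ⟨[], List.isChain_nil, le_rfl, rfl⟩
  | cons l w ih =>
    obtain ⟨w', hr, hlen, hval⟩ := ih
    rw [wordVal_cons, ← hval]
    cases w' with
    | nil => exact ⟨[l], isReduced_singleton l, by simp, by simp⟩
    | cons c u =>
      simp only [List.length_cons] at hlen ⊢
      have hlen' : u.length ≤ w.length + 1 := by omega
      have ha' : a * a = 1 := by rw [← pow_two]; exact ha
      by_cases hlc : l.isA = c.isA
      · cases l <;> cases c <;> simp only [Letter.isA, reduceCtorEq] at hlc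
        · exact ⟨u, hr.tail, hlen', by simp [letterVal, ← mul_assoc, ha']⟩
        · exact ⟨Letter.bInv :: u, hr.replace_head rfl, by simp; omega, by
            simp [letterVal, ← mul_assoc, inv_eq_mul_self hb]⟩
        · exact ⟨u, hr.tail, hlen', by simp [letterVal]⟩
        · exact ⟨u, hr.tail, hlen', by simp [letterVal]⟩
        · exact ⟨Letter.b :: u, hr.replace_head rfl, by simp; omega, by
            simp [letterVal, ← mul_assoc, inv_mul_inv hb]⟩
      · exact ⟨l :: c :: u, isReduced_cons_cons.2 ⟨hlc, hr⟩, by simp; omega, by simp⟩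

/-- The elements represented by words form a subgroup, so generators suffice for surjectivity. -/
lemma exists_wordVal_eq (ha : a ^ 2 = 1) (hgen : Subgroup.closure {a, b} = ⊤) (x : G) :
    ∃ w, wordVal a b w = x := by
  have hx : x ∈ Subgroup.closure {a, b} := by rw [hgen]; trivial
  induction hx using Subgroup.closure_induction with
  | mem y hy =>
    rcases hy with rfl | rfl
    · exact ⟨[Letter.a], by simp [letterVal]⟩
    · exact ⟨[Letter.b], by simp [letterVal]⟩
  | one => exact ⟨[], rfl⟩
  | mul y z _ _ hy hz =>
    obtain ⟨u, rfl⟩ := hy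
    obtain ⟨v, rfl⟩ := hz
    exact ⟨u ++ v, by simp⟩
  | inv y _ hy =>
    obtain ⟨u, rfl⟩ := hy
    exact ⟨invWord u, wordVal_invWord ha u⟩

/-- If no nonempty reduced word represents `1`, then reduced words representing the same element
agree: if they begin with different letters, then one of them, multiplied by the inverse of the
other, is again a nonempty reduced word, once `b b` or `b⁻¹ b⁻¹` at the joint is replaced by `b⁻¹` or
`b`. -/
lemma IsReduced.eq_of_wordVal_eq (ha : a ^ 2 = 1) (hb : b ^ 3 = 1)
    (hfree : ∀ w, IsReduced w → wordVal a b w = 1 → w = []) {w w' : List Letter}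
    (hw : IsReduced w) (hw' : IsReduced w') (h : wordVal a b w = wordVal a b w') : w = w' := by
  induction w generalizing w' with
  | nil => exact (hfree w' hw' (by rw [← h, wordVal_nil])).symm
  | cons l u ih =>
    cases w' with
    | nil => exact hfree _ hw h
    | cons l' u' =>
      -- the contradiction when the two words do not begin with the same letter
      have key : ∀ c : Letter, ∀ v v' : List Letter, IsReduced (PSLHeat.invWord v' ++ c :: v) →
          wordVal a b v' = letterVal a b c * wordVal a b v → False := by
        intro c v v' hr he
        have := hfree _ hr (by rw [wordVal_append, wordVal_invWord ha, he]; simp)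
        simp at this
      by_cases hll : l.isA = l'.isA
      · by_cases hl : l = l'
        · subst hl
          rw [ih hw.tail hw'.tail (by simpa using h)]
        · exfalso
          cases l <;> cases l' <;> simp only [Letter.isA, reduceCtorEq] at hll hl
          all_goals try exact hl trivial
          · -- `b u = b⁻¹ u'` gives `u' = b⁻¹ u`
            refine key Letter.bInv u u' (isReduced_invWord_append hw' (hw.replace_head rfl)) ?_
            simp only [wordVal_cons, letterVal] at h ⊢
            have h2 : b * (b * wordVal a b u) = wordVal a b u' := by rw [h]; simp
            rw [← h2, inv_eq_mul_self hb, mul_assoc]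
          · refine key Letter.b u u' (isReduced_invWord_append hw' (hw.replace_head rfl)) ?_
            simp only [wordVal_cons, letterVal] at h ⊢
            have h2 : b⁻¹ * (b⁻¹ * wordVal a b u) = wordVal a b u' := by rw [h]; simp
            rw [← h2, ← mul_assoc, inv_mul_inv hb]
      · exfalso
        refine key l'.inv (l :: u) u' (isReduced_invWord_append (hw'.replace_head (by simp))
          (isReduced_cons_cons.2 ⟨by simpa using Ne.symm hll, hw⟩)) ?_
        rw [h, letterVal_inv ha]
        simp

/-- The length of a word, with the sign `+` if it starts with `b` or `b⁻¹` and `-` if it starts with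
`a`. -/
def signedLength : List Letter → ℤ
  | [] => 0
  | l :: w => if l.isA then -((w.length : ℤ) + 1) else (w.length : ℤ) + 1

/-- The signed word length of an element is the signed length of its reduced form. -/
lemma proj_wordVal (ha : a ^ 2 = 1) (hb : b ^ 3 = 1)
    (hfree : ∀ w, IsReduced w → wordVal a b w = 1 → w = []) {w : List Letter}
    (hw : IsReduced w) : proj a b (wordVal a b w) = signedLength w := by
  have hlen : wordLength a b (wordVal a b w) = w.length := by
    refine le_antisymm (Nat.sInf_le ⟨w, rfl, rfl⟩) (le_csInf ⟨_, w, rfl, rfl⟩ ?_)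
    rintro n ⟨v, rfl, hv⟩
    obtain ⟨v', hr, hle, hval⟩ := exists_isReduced ha hb v
    rw [hw.eq_of_wordVal_eq ha hb hfree hr (by rw [hval, hv])]
    exact hle
  unfold proj
  rw [hlen]
  cases w with
  | nil => simp [signedLength]
  | cons l u =>
    rw [if_neg fun h => by simpa using hfree _ hw h]
    have hs : StartsWithB a b (wordVal a b (l :: u)) ↔ l.isA = false := by
      constructor
      · rintro ⟨c, v, hc, hr, hv⟩
        obtain ⟨rfl, -⟩ := List.cons.inj (hr.eq_of_wordVal_eq ha hb hfree hw hv)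
        exact hc
      · exact fun h => ⟨l, u, h, hw, rfl⟩
    by_cases h : l.isA <;> simp only [hs, signedLength, h] <;> simp

end Words

/-! ### The Laplacian in the signed word length -/

/-- The operator on functions of the signed word length `n` induced by the normalized Laplacian. The
parity and the sign of `n` determine whether the reduced form of `x` ends with `a`, and the
neighbours of `x` are found by appending a letter to it or by changing or deleting its last one. -/
noncomputable def intLaplacian (f : ℤ → ℝ) (n : ℤ) : ℝ :=
  if 0 ≤ n then
    if Even n then f n - f (n - 1) / 2 - f (n + 1) / 2
    else f n - f (n + 1) / 2 - f n / 4 - f (n - 1) / 4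
  else
    if Even n then f n - f (n - 1) / 2 - f n / 4 - f (n + 1) / 4
    else f n - f (n + 1) / 2 - f (n - 1) / 2

lemma signedLength_concat (h : Letter) (w : List Letter) (l : Letter) :
    signedLength (h :: w ++ [l])
      = signedLength (h :: w) + if h.isA then -1 else 1 := by
  by_cases hh : h.isA
  · simp [signedLength, hh]
    ring
  · simp [signedLength, hh]

/-- The first and the last letter of a reduced word have the same type iff its length is odd. -/
lemma IsReduced.isA_eq_iff {h l : Letter} {u : List Letter} (hw : IsReduced (h :: u ++ [l])) :
    h.isA = l.isA ↔ Odd u.length := by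
  induction u generalizing h with
  | nil =>
    have := (isReduced_cons_cons.1 hw).1
    simpa using this
  | cons c u ih =>
    obtain ⟨h1, h2⟩ := isReduced_cons_cons.1 hw
    have := ih h2
    rw [List.length_cons, Nat.odd_add_one, ← this]
    revert h1
    cases h.isA <;> cases c.isA <;> cases l.isA <;> simp

/-- How appending, deleting or changing the last letter acts on the signed length, and how the signed
length determines the type of the last letter. -/
lemma IsReduced.signedLength_last {v : List Letter} {l : Letter} (hw : IsReduced (v ++ [l])) :
    ∃ n s : ℤ, (∀ l' : Letter, l'.isA = l.isA → signedLength (v ++ [l']) = n) ∧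
      signedLength v = n - s ∧ (∀ l' : Letter, signedLength (v ++ [l] ++ [l']) = n + s) ∧
      (0 < n ∧ s = 1 ∧ (l.isA = true ↔ Even n) ∨ n < 0 ∧ s = -1 ∧ (l.isA = true ↔ ¬ Even n)) := by
  cases v with
  | nil =>
    by_cases hl : l.isA
    · exact ⟨-1, -1, fun l' h => by simp [signedLength, h, hl], by simp [signedLength],
        fun l' => by simp [signedLength, hl], Or.inr (by simp [hl])⟩
    · exact ⟨1, 1, fun l' h => by simp [signedLength, h, hl], by simp [signedLength],
        fun l' => by simp [signedLength, hl], Or.inl (by simp [hl])⟩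
  | cons h u =>
    have hodd := hw.isA_eq_iff
    have happ : ∀ l', signedLength (h :: u ++ [l] ++ [l'])
        = signedLength (h :: u) + (if h.isA then -1 else 1) + if h.isA then -1 else 1 := by
      intro l'
      rw [← signedLength_concat h u l]
      exact signedLength_concat h (u ++ [l]) l'
    refine ⟨signedLength (h :: u) + if h.isA then -1 else 1, if h.isA then -1 else 1,
      fun l' _ => signedLength_concat h u l', by simp, happ, ?_⟩
    rw [← Int.odd_coe_nat] at hodd
    by_cases hh : h.isA
    · simp only [hh, signedLength, if_true] at hodd ⊢
      refine Or.inr ⟨by omega, trivial, ?_⟩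
      rw [eq_comm, hodd]
      grind
    · simp only [hh, signedLength] at hodd ⊢
      have hh' : h.isA = false := by simpa using hh
      refine Or.inl ⟨by simp; omega, by simp, ?_⟩
      have : l.isA = true ↔ ¬ (false = l.isA) := by cases l.isA <;> simp
      rw [this, hodd]
      simp only [Bool.false_eq_true, if_false]
      grind

section Cayley

variable {G : Type*} [Group G] {a b : G}

/-- The normalized Laplacian of a function of the signed word length is `intLaplacian` of it. -/
lemma intLaplacian_proj (ha : a ^ 2 = 1) (hb : b ^ 3 = 1)
    (hfree : ∀ w, IsReduced w → wordVal a b w = 1 → w = []) (hsurj : ∀ x, ∃ w, wordVal a b w = x)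
    (f : ℤ → ℝ) (x : G) :
    f (proj a b x) - f (proj a b (x * a)) / 2 - f (proj a b (x * b)) / 4
      - f (proj a b (x * b⁻¹)) / 4 = intLaplacian f (proj a b x) := by
  obtain ⟨w₀, rfl⟩ := hsurj x
  obtain ⟨w, hw, -, hval⟩ := exists_isReduced ha hb w₀
  rw [← hval]
  clear hval w₀
  have hπ : ∀ {u : List Letter} {y : G}, IsReduced u → wordVal a b u = y →
      proj a b y = signedLength u := by
    rintro u _ hu rfl
    exact proj_wordVal ha hb hfree hu
  have ha' : a * a = 1 := by rw [← pow_two]; exact ha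
  rcases List.eq_nil_or_concat' w with rfl | ⟨v, l, rfl⟩
  · rw [hπ hw rfl, hπ (isReduced_singleton Letter.a) (by simp [letterVal]),
      hπ (isReduced_singleton Letter.b) (by simp [letterVal]),
      hπ (isReduced_singleton Letter.bInv) (by simp [letterVal])]
    simp [signedLength, intLaplacian, Letter.isA]
    ring
  · obtain ⟨n, s, hn, hdel, happ, hs⟩ := hw.signedLength_last
    have hv : IsReduced v := List.IsChain.left_of_append hw
    -- the reduced words obtained by changing the last letter and by appending one
    have hchange : ∀ c : Letter, c.isA = l.isA → IsReduced (v ++ [c]) := by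
      intro c hc
      unfold IsReduced at hw ⊢
      rw [List.isChain_append] at hw ⊢
      simpa [hc] using hw
    have hconcat : ∀ c : Letter, c.isA ≠ l.isA → IsReduced (v ++ [l] ++ [c]) := by
      intro c hc
      unfold IsReduced at hw ⊢
      rw [List.isChain_append]
      exact ⟨hw, List.isChain_singleton _, by simpa using Ne.symm hc⟩
    rw [hπ hw rfl, hn l rfl]
    cases l with
    | a =>
      rw [hπ (y := _ * a) hv (by simp [letterVal, mul_assoc, ha']),
        hπ (y := _ * b) (hconcat Letter.b (by simp [Letter.isA])) (by simp [letterVal, mul_assoc]),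
        hπ (y := _ * b⁻¹) (hconcat Letter.bInv (by simp [Letter.isA]))
          (by simp [letterVal, mul_assoc]), hdel, happ, happ]
      rcases hs with ⟨h0, rfl, he⟩ | ⟨h0, rfl, he⟩
      · rw [intLaplacian, if_pos h0.le, if_pos (he.1 rfl)]
        ring
      · rw [intLaplacian, if_neg h0.not_ge, if_neg (he.1 rfl), sub_neg_eq_add, ← sub_eq_add_neg]
        ring
    | b =>
      rw [hπ (y := _ * a) (hconcat Letter.a (by simp [Letter.isA]))
          (by simp [letterVal, mul_assoc]),
        hπ (y := _ * b) (hchange Letter.bInv rfl)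
          (by simp [letterVal, mul_assoc, inv_eq_mul_self hb]),
        hπ (y := _ * b⁻¹) hv (by simp [letterVal, mul_assoc]), hdel, happ, hn Letter.bInv rfl]
      rcases hs with ⟨h0, rfl, he⟩ | ⟨h0, rfl, he⟩
      · rw [intLaplacian, if_pos h0.le, if_neg fun h => by simpa [Letter.isA] using he.2 h]
      · rw [intLaplacian, if_neg h0.not_ge, if_pos (by simpa [Letter.isA] using he),
          sub_neg_eq_add, ← sub_eq_add_neg]
    | bInv =>
      rw [hπ (y := _ * a) (hconcat Letter.a (by simp [Letter.isA]))
          (by simp [letterVal, mul_assoc]),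
        hπ (y := _ * b) hv (by simp [letterVal, mul_assoc]),
        hπ (y := _ * b⁻¹) (hchange Letter.b rfl)
          (by simp [letterVal, mul_assoc, inv_mul_inv hb]), hdel, happ, hn Letter.b rfl]
      rcases hs with ⟨h0, rfl, he⟩ | ⟨h0, rfl, he⟩
      · rw [intLaplacian, if_pos h0.le, if_neg fun h => by simpa [Letter.isA] using he.2 h]
        ring
      · rw [intLaplacian, if_neg h0.not_ge, if_pos (by simpa [Letter.isA] using he),
          sub_neg_eq_add, ← sub_eq_add_neg]
        ring

/-- The signed word length vanishes only at the identity. -/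
lemma proj_eq_zero_iff (ha : a ^ 2 = 1) (hb : b ^ 3 = 1)
    (hfree : ∀ w, IsReduced w → wordVal a b w = 1 → w = []) (hsurj : ∀ x, ∃ w, wordVal a b w = x)
    (x : G) : proj a b x = 0 ↔ x = 1 := by
  refine ⟨fun h => ?_, fun h => by simp [proj, h]⟩
  obtain ⟨w₀, rfl⟩ := hsurj x
  obtain ⟨w, hw, -, hval⟩ := exists_isReduced ha hb w₀
  rw [← hval] at h ⊢
  rw [proj_wordVal ha hb hfree hw] at h
  cases w with
  | nil => rfl
  | cons l u =>
    exfalso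
    by_cases hl : l.isA <;> simp only [signedLength, hl] at h <;> simp at h <;> omega

end Cayley

/-! ### The modular group as a free product -/

lemma mk_T_eq : (QuotientGroup.mk ModularGroup.T : PSL(2, ℤ)) = genA * genB := by
  have h : ModularGroup.T = -1 * (matA * matB) := by
    apply Subtype.ext
    rw [Matrix.SpecialLinearGroup.coe_mul, Matrix.SpecialLinearGroup.coe_mul]
    ext i j
    fin_cases i <;> fin_cases j <;> simp [ModularGroup.T, matA, matB]
  rw [h, QuotientGroup.mk_mul, (QuotientGroup.eq_one_iff _).2 neg_one_mem_center, one_mul]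
  rfl

lemma closure_genA_genB : Subgroup.closure {genA, genB} = ⊤ := by
  rw [eq_top_iff, ← Subgroup.map_top_of_surjective _ (QuotientGroup.mk'_surjective
    (Subgroup.center SL(2, ℤ))), ← SpecialLinearGroup.SL2Z_generators,
    MonoidHom.map_closure, Subgroup.closure_le]
  have hA : genA ∈ Subgroup.closure {genA, genB} := Subgroup.subset_closure (by simp)
  have hB : genB ∈ Subgroup.closure {genA, genB} := Subgroup.subset_closure (by simp)
  rintro _ ⟨g, rfl | rfl, rfl⟩
  · exact hA
  · change (QuotientGroup.mk ModularGroup.T : PSL(2, ℤ)) ∈ Subgroup.closure {genA, genB}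
    rw [mk_T_eq]
    exact mul_mem hA hB

/-- Ping-pong for the reduced words in `SL(2, ℤ)`: the matrix of `a` exchanges the sets of integer
vectors with `xy > 0` and with `xy < 0` and preserves `x² + y²`, and the matrices of `b` and `b⁻¹`
map the first set to the second and increase `x² + y²`. The vector to start from is chosen according
to the last letter of the word. -/
lemma exists_vector_of_isReduced (l : Letter) (w : List Letter) (hw : IsReduced (l :: w)) :
    ∃ v : Fin 2 → ℤ, v 0 ^ 2 + v 1 ^ 2 = 2 ∧
      (let u := (wordVal matA matB (l :: w)).1 *ᵥ v
       (l.isA = true ∧ 0 < u 0 * u 1 ∨ l.isA = false ∧ u 0 * u 1 < 0) ∧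
        (2 < u 0 ^ 2 + u 1 ^ 2 ∨ l :: w = [Letter.a])) := by
  have hA : ∀ v : Fin 2 → ℤ, matA.1 *ᵥ v = ![-v 1, v 0] := by
    intro v
    ext i
    fin_cases i <;> simp [matA, Matrix.mulVec, dotProduct, Fin.sum_univ_two]
  have hB : ∀ v : Fin 2 → ℤ, matB.1 *ᵥ v = ![-v 1, v 0 + v 1] := by
    intro v
    ext i
    fin_cases i <;> simp [matB, Matrix.mulVec, dotProduct, Fin.sum_univ_two]
  have hB' : ∀ v : Fin 2 → ℤ, matB.1.adjugate *ᵥ v = ![v 0 + v 1, -v 0] := by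
    intro v
    rw [Matrix.adjugate_fin_two]
    ext i
    fin_cases i <;> simp [matB, Matrix.mulVec, dotProduct, Fin.sum_univ_two]
  induction w generalizing l with
  | nil =>
    cases l
    · exact ⟨![-1, 1], by simp, by simp [letterVal, hA, Letter.isA]⟩
    · exact ⟨![1, 1], by simp, by simp [letterVal, hB, Letter.isA]⟩
    · exact ⟨![1, 1], by simp, by simp [letterVal, hB', Letter.isA]⟩
  | cons c w ih =>
    obtain ⟨hlc, hr⟩ := isReduced_cons_cons.1 hw
    obtain ⟨v, hv, hsign, hnorm⟩ := ih c hr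
    refine ⟨v, hv, ?_⟩
    rw [wordVal_cons, Matrix.SpecialLinearGroup.coe_mul, ← Matrix.mulVec_mulVec]
    generalize (wordVal matA matB (c :: w)).1 *ᵥ v = u at hsign hnorm
    cases l <;> cases c <;> simp only [Letter.isA, ne_eq, not_true_eq_false] at hlc <;>
      simp [Letter.isA] at hsign hnorm <;>
      simp [letterVal, hA, hB, hB', Letter.isA] <;>
      constructor <;> nlinarith [sq_nonneg (u 0), sq_nonneg (u 1)]

lemma eq_nil_of_wordVal_genA_genB {w : List Letter} (hw : IsReduced w)
    (h : wordVal genA genB w = 1) : w = [] := by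
  cases w with
  | nil => rfl
  | cons l w =>
    exfalso
    have hmk : wordVal genA genB (l :: w)
        = (QuotientGroup.mk (wordVal matA matB (l :: w)) : PSL(2, ℤ)) :=
      (map_wordVal (QuotientGroup.mk' (Subgroup.center SL(2, ℤ))) matA matB (l :: w)).symm
    rw [hmk, QuotientGroup.eq_one_iff, Matrix.SpecialLinearGroup.mem_center_iff] at h
    obtain ⟨r, hr, hM⟩ := h
    obtain ⟨v, hv, -, hnorm⟩ := exists_vector_of_isReduced l w hw
    rcases hnorm with hnorm | hnorm
    · rw [← hM] at hnorm
      have hr' : r ^ 2 = 1 := by simpa using hr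
      have : (r * v 0) ^ 2 + (r * v 1) ^ 2 = 2 := by
        rw [mul_pow, mul_pow, hr', one_mul, one_mul, hv]
      simp at hnorm
      omega
    · rw [hnorm, wordVal_cons, wordVal_nil, mul_one] at hM
      have h10 := congrFun (congrFun hM 1) 0
      rw [Matrix.scalar_apply, Matrix.diagonal_apply_ne _ (by decide)] at h10
      simp [letterVal, matA] at h10

lemma exists_wordVal_genA_genB (x : PSL(2, ℤ)) : ∃ w, wordVal genA genB w = x :=
  exists_wordVal_eq genA_sq closure_genA_genB x

/-- In the presented group every element is the value of a reduced word, and only the empty one has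
trivial image in `PSL(2, ℤ)`. -/
lemma presentationHom_bijective : Function.Bijective presentationHom := by
  have ha : presentationHom (PresentedGroup.of Gen.a) = genA := by
    simp [presentationHom, genMap]
  have hb : presentationHom (PresentedGroup.of Gen.b) = genB := by
    simp [presentationHom, genMap]
  have hmap : ∀ w, presentationHom
      (wordVal (PresentedGroup.of Gen.a) (PresentedGroup.of Gen.b) w) = wordVal genA genB w := by
    intro w
    rw [map_wordVal, ha, hb]
  constructor
  · rw [injective_iff_map_eq_one]
    intro g hg
    have ha2 : (PresentedGroup.of Gen.a : PresentedGroup relators) ^ 2 = 1 :=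
      PresentedGroup.one_of_mem (rels := relators) (Or.inl rfl)
    have hb3 : (PresentedGroup.of Gen.b : PresentedGroup relators) ^ 3 = 1 :=
      PresentedGroup.one_of_mem (rels := relators) (Or.inr rfl)
    have hgen : Subgroup.closure {PresentedGroup.of Gen.a, PresentedGroup.of Gen.b}
        = (⊤ : Subgroup (PresentedGroup relators)) := by
      rw [← PresentedGroup.closure_range_of relators]
      congr 1
      ext x
      constructor
      · rintro (rfl | rfl) <;> exact Set.mem_range_self _
      · rintro ⟨_ | _, rfl⟩ <;> simp
    obtain ⟨w₀, rfl⟩ := exists_wordVal_eq ha2 hgen g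
    obtain ⟨w, hw, -, hval⟩ := exists_isReduced ha2 hb3 w₀
    rw [← hval] at hg ⊢
    rw [hmap] at hg
    rw [eq_nil_of_wordVal_genA_genB hw hg, wordVal_nil]
  · intro x
    obtain ⟨w, rfl⟩ := exists_wordVal_genA_genB x
    exact ⟨_, hmap w⟩

/-! ### Eigenfunctions of the Laplacian on the integers -/

lemma halfCeil_two_mul (m : ℤ) : halfCeil (2 * m) = m := by
  rw [halfCeil, Int.ceil_eq_iff]
  push_cast
  constructor <;> linarith

lemma halfCeil_two_mul_add_one (m : ℤ) : halfCeil (2 * m + 1) = m + 1 := by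
  rw [halfCeil, Int.ceil_eq_iff]
  push_cast
  constructor <;> linarith

lemma intLaplacian_even_of_nonneg (f : ℤ → ℝ) {m : ℤ} (hm : 0 ≤ m) :
    intLaplacian f (2 * m) = f (2 * m) - f (2 * (m - 1) + 1) / 2 - f (2 * m + 1) / 2 := by
  rw [intLaplacian, if_pos (by omega), if_pos (even_two_mul m)]
  ring_nf

lemma intLaplacian_odd_of_nonneg (f : ℤ → ℝ) {m : ℤ} (hm : 0 ≤ m) :
    intLaplacian f (2 * m + 1)
      = f (2 * m + 1) - f (2 * (m + 1)) / 2 - f (2 * m + 1) / 4 - f (2 * m) / 4 := by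
  rw [intLaplacian, if_pos (by omega), if_neg (by simp)]
  ring_nf

lemma intLaplacian_even_of_neg (f : ℤ → ℝ) {m : ℤ} (hm : m < 0) :
    intLaplacian f (2 * m)
      = f (2 * m) - f (2 * (m - 1) + 1) / 2 - f (2 * m) / 4 - f (2 * m + 1) / 4 := by
  rw [intLaplacian, if_neg (by omega), if_pos (even_two_mul m)]
  ring_nf

lemma intLaplacian_odd_of_neg (f : ℤ → ℝ) {m : ℤ} (hm : m < 0) :
    intLaplacian f (2 * m + 1)
      = f (2 * m + 1) - f (2 * (m + 1)) / 2 - f (2 * m) / 2 := by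
  rw [intLaplacian, if_neg (by omega), if_neg (by simp)]
  ring_nf

/-- To verify an eigenvalue equation for `intLaplacian`, one may use one formula for `f` on `n ≥ -1`
and another one on `n ≤ 0`: these ranges contain the neighbours of the `n ≥ 0` and of the `n < 0`. -/
lemma intLaplacian_eq_of_formulas {f e o e' o' : ℤ → ℝ} {lam : ℝ}
    (he : ∀ m, 0 ≤ m → f (2 * m) = e m) (ho : ∀ m, -1 ≤ m → f (2 * m + 1) = o m)
    (he' : ∀ m, m ≤ 0 → f (2 * m) = e' m) (ho' : ∀ m, m < 0 → f (2 * m + 1) = o' m)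
    (h₁ : ∀ m, e m - o (m - 1) / 2 - o m / 2 = lam * e m)
    (h₂ : ∀ m, o m - e (m + 1) / 2 - o m / 4 - e m / 4 = lam * o m)
    (h₃ : ∀ m, e' m - o' (m - 1) / 2 - e' m / 4 - o' m / 4 = lam * e' m)
    (h₄ : ∀ m, o' m - e' (m + 1) / 2 - e' m / 2 = lam * o' m) (n : ℤ) :
    intLaplacian f n = lam * f n := by
  obtain ⟨m, rfl | rfl⟩ := Int.even_or_odd' n
  · rcases le_or_gt 0 m with hm | hm
    · rw [intLaplacian_even_of_nonneg f hm, he m hm, ho _ (by omega), ho _ (by omega), h₁]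
    · rw [intLaplacian_even_of_neg f hm, he' m hm.le, ho' _ (by omega), ho' _ (by omega), h₃]
  · rcases le_or_gt 0 m with hm | hm
    · rw [intLaplacian_odd_of_nonneg f hm, he m hm, ho _ (by omega), he _ (by omega), h₂]
    · rw [intLaplacian_odd_of_neg f hm, he' m hm.le, ho' _ (by omega), he' _ (by omega), h₄]

lemma alpha_even (m : ℤ) : alpha (2 * m) = (-1) ^ m * 2 ^ (-|m|) / 6 := by
  unfold alpha
  rw [halfCeil_two_mul]
  split_ifs with h
  · rw [abs_of_nonneg (by omega)]
  · rw [abs_of_neg (by omega), neg_neg]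

lemma beta_even (m : ℤ) : beta (2 * m) = 2 ^ (-|m|) / 6 := by
  unfold beta
  simp only [halfCeil_two_mul, (even_two_mul m).neg_one_zpow, one_mul]
  split_ifs with h
  · rw [abs_of_nonneg (by omega)]
  · rw [abs_of_neg (by omega), neg_neg]

lemma alpha_odd (m : ℤ) : alpha (2 * m + 1) = (-1) ^ (m + 1) * 2 ^ (-|m + 1|) / 6 := by
  unfold alpha
  rw [halfCeil_two_mul_add_one]
  split_ifs with h
  · rw [abs_of_nonneg (by omega)]
  · rw [abs_of_nonpos (by omega), neg_neg]

lemma beta_odd (m : ℤ) : beta (2 * m + 1) = -(2 ^ (-|m + 1|) / 6) := by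
  unfold beta
  rw [halfCeil_two_mul_add_one, Odd.neg_one_zpow (odd_two_mul_add_one m)]
  split_ifs with h
  · rw [abs_of_nonneg (by omega)]
    ring
  · rw [abs_of_nonpos (by omega), neg_neg]
    ring

lemma intLaplacian_alpha (n : ℤ) : intLaplacian alpha n = 3 / 4 * alpha n := by
  refine intLaplacian_eq_of_formulas (e := fun m => (-1) ^ m * 2 ^ (-m) / 6)
    (o := fun m => (-1) ^ (m + 1) * 2 ^ (-(m + 1)) / 6) (e' := fun m => (-1) ^ m * 2 ^ m / 6)
    (o' := fun m => (-1) ^ (m + 1) * 2 ^ (m + 1) / 6)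
    (fun m hm => by rw [alpha_even, abs_of_nonneg hm])
    (fun m hm => by rw [alpha_odd, abs_of_nonneg (by omega)])
    (fun m hm => by rw [alpha_even, abs_of_nonpos hm, neg_neg])
    (fun m hm => by rw [alpha_odd, abs_of_nonpos (by omega), neg_neg]) ?_ ?_ ?_ ?_ n <;>
  · intro m
    simp only [zpow_neg, zpow_add_one₀ (two_ne_zero' ℝ), sub_add_cancel,
      zpow_add_one₀ (neg_ne_zero.2 (one_ne_zero' ℝ)), mul_inv]
    ring

lemma intLaplacian_beta (n : ℤ) : intLaplacian beta n = 7 / 4 * beta n := by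
  refine intLaplacian_eq_of_formulas (e := fun m => 2 ^ (-m) / 6)
    (o := fun m => -(2 ^ (-(m + 1)) / 6)) (e' := fun m => 2 ^ m / 6)
    (o' := fun m => -(2 ^ (m + 1) / 6))
    (fun m hm => by rw [beta_even, abs_of_nonneg hm])
    (fun m hm => by rw [beta_odd, abs_of_nonneg (by omega)])
    (fun m hm => by rw [beta_even, abs_of_nonpos hm, neg_neg])
    (fun m hm => by rw [beta_odd, abs_of_nonpos (by omega), neg_neg]) ?_ ?_ ?_ ?_ n <;>
  · intro m
    simp only [zpow_neg, zpow_add_one₀ (two_ne_zero' ℝ), sub_add_cancel, mul_inv]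
    ring

/-- The common form of `γ_n^±(s)`: a function of `n` which depends on a square root `ρ` of
`25/16 + √2 cos s`. The root `R s` gives `γ_n^+(s)` and the root `-R s` gives `γ_n^-(s)`. -/
noncomputable def gammaRoot (ρ s : ℝ) (n : ℤ) : ℝ :=
  let m : ℝ := ((n / 2 : ℤ) : ℝ)
  if 0 ≤ n then
    √2 ^ (-halfCeil n) * Real.sin s / (Real.pi * ρ * (1 + 8 * Real.sin s ^ 2)) *
      (if Even n then
        -(√2 + Real.cos s) * Real.sin (m * s) + 4 * ρ * Real.sin s * Real.cos (m * s)
      else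
        (4 + 2 * √2 * Real.cos s) * Real.sin (m * s)
          + (√2 * ρ - (9 * √2 / 4 + 4 * Real.cos s)) * Real.sin ((m + 1) * s))
  else
    √2 ^ halfCeil n * Real.sin s / (Real.pi * ρ * (1 + 8 * Real.sin s ^ 2)) *
      (if Even n then
        (√2 + Real.cos s) * Real.sin (m * s) + 4 * ρ * Real.sin s * Real.cos (m * s)
      else
        (4 + 2 * √2 * Real.cos s) * Real.sin (m * s)
          - (√2 * ρ + (9 * √2 / 4 + 4 * Real.cos s)) * Real.sin ((m + 1) * s))

lemma gammaPlus_eq (n : ℤ) (s : ℝ) : gammaPlus n s = gammaRoot (R s) s n := rfl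

lemma gammaMinus_eq (n : ℤ) (s : ℝ) : gammaMinus n s = gammaRoot (-R s) s n := by
  unfold gammaMinus gammaRoot
  simp only [mul_neg, neg_mul, div_neg]
  split_ifs <;> ring

lemma gammaRoot_even_of_nonneg (ρ s : ℝ) {m : ℤ} (hm : 0 ≤ m) :
    gammaRoot ρ s (2 * m) = Real.sin s / (Real.pi * ρ * (1 + 8 * Real.sin s ^ 2)) *
      (√2 ^ (-m) * (-(√2 + Real.cos s) * Real.sin (m * s)
        + 4 * ρ * Real.sin s * Real.cos (m * s))) := by
  have h2 : 2 * m / 2 = m := by omega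
  simp only [gammaRoot, halfCeil_two_mul, h2]
  rw [if_pos (by omega), if_pos (even_two_mul m)]
  ring

/-- The formula for `n ≥ 0` also holds at `n = -1`. -/
lemma gammaRoot_odd_of_neg_one_le (ρ s : ℝ) {m : ℤ} (hm : -1 ≤ m) :
    gammaRoot ρ s (2 * m + 1) = Real.sin s / (Real.pi * ρ * (1 + 8 * Real.sin s ^ 2)) *
      (√2 ^ (-(m + 1)) * ((4 + 2 * √2 * Real.cos s) * Real.sin (m * s)
        + (√2 * ρ - (9 * √2 / 4 + 4 * Real.cos s)) * Real.sin ((m + 1) * s))) := by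
  have h2 : (2 * m + 1) / 2 = m := by omega
  simp only [gammaRoot, halfCeil_two_mul_add_one, h2]
  rw [if_neg (by simp : ¬ Even (2 * m + 1))]
  rcases hm.eq_or_lt with rfl | hm
  · simp
  · rw [if_pos (by omega)]
    ring

/-- The formula for `n < 0` also holds at `n = 0`. -/
lemma gammaRoot_even_of_nonpos (ρ s : ℝ) {m : ℤ} (hm : m ≤ 0) :
    gammaRoot ρ s (2 * m) = Real.sin s / (Real.pi * ρ * (1 + 8 * Real.sin s ^ 2)) *
      (√2 ^ m * ((√2 + Real.cos s) * Real.sin (m * s)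
        + 4 * ρ * Real.sin s * Real.cos (m * s))) := by
  rcases hm.eq_or_lt with rfl | hm
  · rw [gammaRoot_even_of_nonneg ρ s le_rfl]
    simp
  · have h2 : 2 * m / 2 = m := by omega
    simp only [gammaRoot, halfCeil_two_mul, h2]
    rw [if_neg (by omega), if_pos (even_two_mul m)]
    ring

lemma gammaRoot_odd_of_neg (ρ s : ℝ) {m : ℤ} (hm : m < 0) :
    gammaRoot ρ s (2 * m + 1) = Real.sin s / (Real.pi * ρ * (1 + 8 * Real.sin s ^ 2)) *
      (√2 ^ (m + 1) * ((4 + 2 * √2 * Real.cos s) * Real.sin (m * s)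
        - (√2 * ρ + (9 * √2 / 4 + 4 * Real.cos s)) * Real.sin ((m + 1) * s))) := by
  have h2 : (2 * m + 1) / 2 = m := by omega
  simp only [gammaRoot, halfCeil_two_mul_add_one, h2]
  rw [if_neg (by omega), if_neg (by simp)]
  ring

/-- For both square roots `ρ` of `25/16 + √2 cos s`, the coefficients are an eigenfunction. -/
lemma intLaplacian_gammaRoot {ρ s : ℝ} (hρ : ρ ^ 2 = 25 / 16 + √2 * Real.cos s) (n : ℤ) :
    intLaplacian (gammaRoot ρ s) n = (7 / 8 + ρ / 2) * gammaRoot ρ s n := by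
  refine intLaplacian_eq_of_formulas (fun m => gammaRoot_even_of_nonneg ρ s)
    (fun m => gammaRoot_odd_of_neg_one_le ρ s) (fun m => gammaRoot_even_of_nonpos ρ s)
    (fun m => gammaRoot_odd_of_neg ρ s) ?_ ?_ ?_ ?_ n <;> intro m
  all_goals
    have hr : √2 ^ 2 = (2 : ℝ) := Real.sq_sqrt (by norm_num)
    have hr0 : √2 ≠ (0 : ℝ) := by positivity
    have hinv : (√2)⁻¹ = √2 / 2 := by field_simp; linarith
    have hcs := Real.sin_sq_add_cos_sq s
    have e1 : ((m : ℝ) - 1) * s = m * s - s := by ring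
    have e2 : ((m : ℝ) + 1) * s = m * s + s := by ring
    simp only [Int.cast_add, Int.cast_sub, Int.cast_one, zpow_neg, sub_add_cancel,
      zpow_add_one₀ hr0, mul_inv, hinv, e1, e2, Real.sin_add, Real.sin_sub, Real.cos_add]
    generalize Real.sin s / (Real.pi * ρ * (1 + 8 * Real.sin s ^ 2)) = A
    generalize Real.sin (m * s) = X
    generalize Real.cos (m * s) = Y
    generalize Real.sin s = S at *
    generalize Real.cos s = C at *
    generalize √(2 : ℝ) = r at *
    try generalize (r ^ m)⁻¹ = c
    try generalize r ^ m = c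
    grind

lemma sixteenth_lt (s : ℝ) : 1 / 16 < 25 / 16 + √2 * Real.cos s := by
  have h : √2 < (3 : ℝ) / 2 := by
    rw [Real.sqrt_lt' (by norm_num)]
    norm_num
  nlinarith [Real.neg_one_le_cos s, Real.sqrt_nonneg (2 : ℝ)]

lemma R_sq (s : ℝ) : R s ^ 2 = 25 / 16 + √2 * Real.cos s :=
  Real.sq_sqrt (by linarith [sixteenth_lt s])

lemma R_pos (s : ℝ) : 0 < R s := Real.sqrt_pos.2 (by linarith [sixteenth_lt s])

lemma intLaplacian_gammaPlus (n : ℤ) (s : ℝ) :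
    intLaplacian (fun k => gammaPlus k s) n = (7 / 8 + R s / 2) * gammaPlus n s :=
  intLaplacian_gammaRoot (R_sq s) n

lemma intLaplacian_gammaMinus (n : ℤ) (s : ℝ) :
    intLaplacian (fun k => gammaMinus k s) n = (7 / 8 - R s / 2) * gammaMinus n s := by
  simp only [gammaMinus_eq]
  rw [intLaplacian_gammaRoot (by rw [neg_sq, R_sq])]
  ring

/-! ### Cosine integrals against the Poisson kernel -/

/-- The cosine coefficients of `1 / (1 + 8 sin² s) = 1 / (5 - 4 cos 2s)`, which is a third of the
Poisson kernel at `2s` for the radius `1/2`. -/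
noncomputable def poissonIntegral (m : ℤ) : ℝ :=
  ∫ s in (0 : ℝ)..Real.pi, Real.cos (m * s) / (1 + 8 * Real.sin s ^ 2)

lemma one_add_sin_sq_pos (s : ℝ) : 0 < 1 + 8 * Real.sin s ^ 2 := by positivity

lemma continuous_cos_div (m : ℤ) :
    Continuous fun s : ℝ => Real.cos (m * s) / (1 + 8 * Real.sin s ^ 2) :=
  Continuous.div (by fun_prop) (by fun_prop) fun s => (one_add_sin_sq_pos s).ne'

lemma integral_cos_int_mul {m : ℤ} (hm : m ≠ 0) :
    ∫ s in (0 : ℝ)..Real.pi, Real.cos (m * s) = 0 := by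
  rw [intervalIntegral.integral_comp_mul_left (fun s => Real.cos s) (Int.cast_ne_zero.2 hm),
    integral_cos]
  simp [Real.sin_int_mul_pi]

lemma poissonIntegral_neg (m : ℤ) : poissonIntegral (-m) = poissonIntegral m := by
  simp [poissonIntegral]

lemma poissonIntegral_recurrence (m : ℤ) :
    5 * poissonIntegral m - 2 * poissonIntegral (m + 2) - 2 * poissonIntegral (m - 2)
      = ∫ s in (0 : ℝ)..Real.pi, Real.cos (m * s) := by
  have hi : ∀ k, IntervalIntegrable (fun s : ℝ => Real.cos ((k : ℤ) * s) / (1 + 8 * Real.sin s ^ 2))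
      MeasureTheory.volume 0 Real.pi := fun k => (continuous_cos_div k).intervalIntegrable _ _
  unfold poissonIntegral
  simp only [← intervalIntegral.integral_const_mul]
  rw [← intervalIntegral.integral_sub ((hi _).const_mul _) ((hi _).const_mul _),
    ← intervalIntegral.integral_sub (((hi _).const_mul _).sub ((hi _).const_mul _))
      ((hi _).const_mul _)]
  refine intervalIntegral.integral_congr fun s _ => ?_
  have h0 := (one_add_sin_sq_pos s).ne'
  have e1 : ((m + 2 : ℤ) : ℝ) * s = m * s + 2 * s := by push_cast; ring
  have e2 : ((m - 2 : ℤ) : ℝ) * s = m * s - 2 * s := by push_cast; ring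
  simp only [e1, e2, Real.cos_add, Real.cos_sub, Real.cos_two_mul, Real.cos_sq']
  field_simp
  ring

lemma abs_poissonIntegral_le (m : ℤ) : |poissonIntegral m| ≤ Real.pi := by
  have h := intervalIntegral.norm_integral_le_of_norm_le_const (a := 0) (b := Real.pi) (C := 1)
    (f := fun s : ℝ => Real.cos (m * s) / (1 + 8 * Real.sin s ^ 2)) fun s _ => by
      rw [Real.norm_eq_abs, abs_div, abs_of_pos (one_add_sin_sq_pos s),
        div_le_one (one_add_sin_sq_pos s)]
      nlinarith [Real.abs_cos_le_one (m * s), sq_nonneg (Real.sin s)]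
  simpa [poissonIntegral, abs_of_pos Real.pi_pos] using h

/-- The odd coefficients vanish by the symmetry `s ↦ π - s`. -/
lemma poissonIntegral_odd (j : ℤ) : poissonIntegral (2 * j + 1) = 0 := by
  have h : poissonIntegral (2 * j + 1) = -poissonIntegral (2 * j + 1) := by
    have h1 := intervalIntegral.integral_comp_sub_left (a := 0) (b := Real.pi)
      (fun s : ℝ => Real.cos ((2 * j + 1 : ℤ) * s) / (1 + 8 * Real.sin s ^ 2)) Real.pi
    rw [sub_self, sub_zero] at h1
    unfold poissonIntegral
    rw [← intervalIntegral.integral_neg, ← h1]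
    refine intervalIntegral.integral_congr fun s _ => ?_
    have e : ((2 * j + 1 : ℤ) : ℝ) * (Real.pi - s)
        = Real.pi - (2 * j + 1 : ℤ) * s + j * (2 * Real.pi) := by
      push_cast
      ring
    simp only [e, Real.cos_add_int_mul_two_pi, Real.cos_pi_sub, Real.sin_pi_sub, neg_div]
  linarith

/-- The recurrence makes `2 J (2 (j + 1)) - J (2 j)` grow like `2 ^ j`, unless it vanishes. -/
lemma two_mul_poissonIntegral_succ (j : ℕ) :
    2 * poissonIntegral (2 * (j + 1)) = poissonIntegral (2 * j) := by
  have hpow : ∀ i : ℕ, 2 * poissonIntegral (2 * (i + 1)) - poissonIntegral (2 * i)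
      = 2 ^ i * (2 * poissonIntegral 2 - poissonIntegral 0) := by
    intro i
    induction i with
    | zero => simp
    | succ i ih =>
      have h := poissonIntegral_recurrence (2 * (i + 1))
      rw [integral_cos_int_mul (by omega)] at h
      have e1 : (2 * (i + 1) + 2 : ℤ) = 2 * (((i + 1 : ℕ) : ℤ) + 1) := by push_cast; ring
      have e2 : (2 * (i + 1) - 2 : ℤ) = 2 * i := by ring
      rw [e1, e2] at h
      rw [pow_succ]
      push_cast at h ⊢
      linarith
  have h0 : 2 * poissonIntegral 2 - poissonIntegral 0 = 0 := by
    by_contra hne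
    obtain ⟨i, hi⟩ := pow_unbounded_of_one_lt
      (3 * Real.pi / |2 * poissonIntegral 2 - poissonIntegral 0|) (one_lt_two : (1 : ℝ) < 2)
    rw [div_lt_iff₀ (abs_pos.2 hne)] at hi
    have h2 : |2 ^ i * (2 * poissonIntegral 2 - poissonIntegral 0)|
        = 2 ^ i * |2 * poissonIntegral 2 - poissonIntegral 0| := by
      rw [abs_mul, abs_of_pos (by positivity)]
    rw [← h2, ← hpow i] at hi
    have h3 := abs_le.1 (abs_poissonIntegral_le (2 * (i + 1)))
    have h4 := abs_le.1 (abs_poissonIntegral_le (2 * i))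
    have h5 : |2 * poissonIntegral (2 * (i + 1)) - poissonIntegral (2 * i)| ≤ 3 * Real.pi :=
      abs_le.2 ⟨by linarith [h3.1, h4.2], by linarith [h3.2, h4.1]⟩
    linarith
  have := hpow j
  rw [h0, mul_zero] at this
  linarith

lemma poissonIntegral_two_mul_nat (j : ℕ) :
    poissonIntegral (2 * j) = Real.pi / 3 * 2 ^ (-(j : ℤ)) := by
  induction j with
  | zero =>
    have h := poissonIntegral_recurrence 0
    have h1 := two_mul_poissonIntegral_succ 0
    rw [zero_add, zero_sub, poissonIntegral_neg] at h
    simp at h h1 ⊢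
    linarith
  | succ j ih =>
    have h := two_mul_poissonIntegral_succ j
    rw [ih] at h
    push_cast
    rw [zpow_neg, zpow_add_one₀ two_ne_zero, mul_inv, ← zpow_neg]
    linarith

lemma poissonIntegral_even (j : ℤ) : poissonIntegral (2 * j) = Real.pi / 3 * 2 ^ (-|j|) := by
  obtain ⟨i, rfl | rfl⟩ := Int.eq_nat_or_neg j
  · rw [poissonIntegral_two_mul_nat, Nat.abs_cast]
  · rw [mul_neg, poissonIntegral_neg, poissonIntegral_two_mul_nat, abs_neg, Nat.abs_cast]

/-! ### The spectral moments -/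

lemma continuous_R : Continuous R := by
  unfold R
  fun_prop

lemma continuous_gammaRoot {ρ : ℝ → ℝ} (hρ : Continuous ρ) (h0 : ∀ s, ρ s ≠ 0) (n : ℤ) :
    Continuous fun s => gammaRoot (ρ s) s n := by
  unfold gammaRoot
  have hden : Continuous fun s : ℝ => Real.pi * ρ s * (1 + 8 * Real.sin s ^ 2) := by fun_prop
  have hne : ∀ s : ℝ, Real.pi * ρ s * (1 + 8 * Real.sin s ^ 2) ≠ 0 := fun s =>
    mul_ne_zero (mul_ne_zero Real.pi_ne_zero (h0 s)) (one_add_sin_sq_pos s).ne'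
  simp only
  split_ifs <;> exact (Continuous.div (by fun_prop) hden hne).mul (by fun_prop)

lemma continuous_gammaPlus (n : ℤ) : Continuous fun s => gammaPlus n s :=
  continuous_gammaRoot continuous_R (fun s => (R_pos s).ne') n

lemma continuous_gammaMinus (n : ℤ) : Continuous fun s => gammaMinus n s := by
  simp only [gammaMinus_eq]
  exact continuous_gammaRoot continuous_R.neg (fun s => neg_ne_zero.2 (R_pos s).ne') n

/-- The `k`-th moment of the signed spectral measure whose Laplace transform is `K t n`. -/
noncomputable def moment (k : ℕ) (n : ℤ) : ℝ :=
  (3 / 4) ^ k * alpha n + (7 / 4) ^ k * beta n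
    + (∫ s in (0 : ℝ)..Real.pi, (7 / 8 - R s / 2) ^ k * gammaMinus n s)
    + (∫ s in (0 : ℝ)..Real.pi, (7 / 8 + R s / 2) ^ k * gammaPlus n s)

lemma intLaplacian_add (f g : ℤ → ℝ) (n : ℤ) :
    intLaplacian (fun k => f k + g k) n = intLaplacian f n + intLaplacian g n := by
  unfold intLaplacian
  split_ifs <;> ring

lemma intLaplacian_const_mul (c : ℝ) (f : ℤ → ℝ) (n : ℤ) :
    intLaplacian (fun k => c * f k) n = c * intLaplacian f n := by
  unfold intLaplacian
  split_ifs <;> ring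

lemma intLaplacian_integral {F : ℝ → ℤ → ℝ} (hF : ∀ n, Continuous fun s => F s n) (a b : ℝ)
    (n : ℤ) : intLaplacian (fun k => ∫ s in a..b, F s k) n = ∫ s in a..b, intLaplacian (F s) n := by
  have hi : ∀ k, IntervalIntegrable (fun s => F s k) MeasureTheory.volume a b := fun k =>
    (hF k).intervalIntegrable a b
  unfold intLaplacian
  split_ifs <;>
  simp only [← intervalIntegral.integral_div] <;>
  repeat rw [intervalIntegral.integral_sub]
  all_goals
    apply Continuous.intervalIntegrable
    fun_prop

lemma intLaplacian_moment (k : ℕ) (n : ℤ) : intLaplacian (moment k) n = moment (k + 1) n := by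
  have hR := continuous_R
  have hp := continuous_gammaPlus
  have hm := continuous_gammaMinus
  unfold moment
  rw [intLaplacian_add, intLaplacian_add, intLaplacian_add, intLaplacian_const_mul,
    intLaplacian_const_mul, intLaplacian_alpha, intLaplacian_beta,
    intLaplacian_integral (F := fun s n => (7 / 8 - R s / 2) ^ k * gammaMinus n s)
      (by intro n; fun_prop),
    intLaplacian_integral (F := fun s n => (7 / 8 + R s / 2) ^ k * gammaPlus n s)
      (by intro n; fun_prop)]
  simp only [intLaplacian_const_mul, intLaplacian_gammaPlus, intLaplacian_gammaMinus, pow_succ,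
    mul_assoc]

/-- On adding up `γ_n^+` and `γ_n^-` the square root `R s` cancels. -/
lemma gammaMinus_add_gammaPlus_even (m : ℤ) (s : ℝ) :
    gammaMinus (2 * m) s + gammaPlus (2 * m) s = √2 ^ (-|m|) / Real.pi *
      (Real.cos (m * s) - Real.cos (m * s) / (1 + 8 * Real.sin s ^ 2)) := by
  have h0 := (one_add_sin_sq_pos s).ne'
  have hR := (R_pos s).ne'
  rw [gammaMinus_eq, gammaPlus_eq]
  rcases le_total 0 m with hm | hm
  · rw [gammaRoot_even_of_nonneg _ _ hm, gammaRoot_even_of_nonneg _ _ hm, abs_of_nonneg hm]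
    field_simp
    ring
  · rw [gammaRoot_even_of_nonpos _ _ hm, gammaRoot_even_of_nonpos _ _ hm, abs_of_nonpos hm, neg_neg]
    field_simp
    ring

lemma gammaMinus_add_gammaPlus_odd (m : ℤ) (s : ℝ) :
    gammaMinus (2 * m + 1) s + gammaPlus (2 * m + 1) s =
      (if 0 ≤ m then 1 else -1) * √2 ^ (1 - |m + 1|) / Real.pi *
        (Real.cos (m * s) / (1 + 8 * Real.sin s ^ 2)
          - Real.cos ((m + 2 : ℤ) * s) / (1 + 8 * Real.sin s ^ 2)) := by
  have h0 := (one_add_sin_sq_pos s).ne'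
  have hR := (R_pos s).ne'
  have hcs : Real.cos (m * s) - Real.cos ((m + 2 : ℤ) * s)
      = 2 * Real.sin s * Real.sin ((m + 1) * s) := by
    have e1 : (m : ℝ) * s = (m + 1) * s - s := by ring
    have e2 : ((m + 2 : ℤ) : ℝ) * s = (m + 1) * s + s := by push_cast; ring
    rw [e1, e2, Real.cos_add, Real.cos_sub]
    ring
  rw [gammaMinus_eq, gammaPlus_eq, ← sub_div, hcs, sub_eq_add_neg (1 : ℤ),
    zpow_add₀ (by positivity), zpow_one]
  split_ifs with hm
  · rw [gammaRoot_odd_of_neg_one_le _ _ (by omega), gammaRoot_odd_of_neg_one_le _ _ (by omega),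
      abs_of_nonneg (by omega)]
    field_simp
    ring
  · rw [gammaRoot_odd_of_neg _ _ (by omega), gammaRoot_odd_of_neg _ _ (by omega),
      abs_of_nonpos (by omega), neg_neg]
    field_simp
    ring

lemma sqrt_two_zpow_two_mul (j : ℤ) : √2 ^ (2 * j) = (2 : ℝ) ^ j := by
  rw [zpow_mul, zpow_ofNat, Real.sq_sqrt zero_le_two]

/-- The zeroth moments, that is, the values of `K 0`. -/
lemma moment_zero (n : ℤ) : moment 0 n = if n = 0 then 1 else 0 := by
  have hadd : moment 0 n = alpha n + beta n
      + ∫ s in (0 : ℝ)..Real.pi, gammaMinus n s + gammaPlus n s := by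
    rw [intervalIntegral.integral_add ((continuous_gammaMinus n).intervalIntegrable _ _)
      ((continuous_gammaPlus n).intervalIntegrable _ _)]
    simp [moment]
    ring
  have hpi := Real.pi_ne_zero
  have hi : ∀ k, IntervalIntegrable (fun s : ℝ => Real.cos ((k : ℤ) * s) / (1 + 8 * Real.sin s ^ 2))
      MeasureTheory.volume 0 Real.pi := fun k => (continuous_cos_div k).intervalIntegrable _ _
  rw [hadd]
  obtain ⟨m, rfl | rfl⟩ := Int.even_or_odd' n
  · simp only [gammaMinus_add_gammaPlus_even, intervalIntegral.integral_const_mul]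
    rw [intervalIntegral.integral_sub (Continuous.intervalIntegrable (by fun_prop) _ _) (hi m)]
    change alpha (2 * m) + beta (2 * m) + √2 ^ (-|m|) / Real.pi *
      ((∫ s in (0 : ℝ)..Real.pi, Real.cos (m * s)) - poissonIntegral m) = _
    rw [alpha_even, beta_even]
    rcases eq_or_ne m 0 with rfl | hm
    · have := poissonIntegral_even 0
      simp at this ⊢
      rw [this]
      field_simp
      norm_num
    · rw [integral_cos_int_mul hm, if_neg (by omega)]
      obtain ⟨j, rfl | rfl⟩ := Int.even_or_odd' m
      · have e : -|2 * j| = 2 * -|j| := by rw [abs_mul]; simp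
        rw [(even_two_mul j).neg_one_zpow, poissonIntegral_even, e, sqrt_two_zpow_two_mul, two_mul,
          zpow_add₀ two_ne_zero]
        field_simp
        ring
      · rw [poissonIntegral_odd, Odd.neg_one_zpow (odd_two_mul_add_one j)]
        ring
  · simp only [gammaMinus_add_gammaPlus_odd, intervalIntegral.integral_const_mul]
    rw [intervalIntegral.integral_sub (hi m) (hi (m + 2)), if_neg (by omega : ¬ 2 * m + 1 = 0)]
    change alpha (2 * m + 1) + beta (2 * m + 1) +
      (if 0 ≤ m then 1 else -1) * √2 ^ (1 - |m + 1|) / Real.pi *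
        (poissonIntegral m - poissonIntegral (m + 2)) = _
    rw [alpha_odd, beta_odd]
    obtain ⟨j, rfl | rfl⟩ := Int.even_or_odd' m
    · have e : 2 * j + 2 = 2 * (j + 1) := by ring
      rw [e, poissonIntegral_even, poissonIntegral_even, Odd.neg_one_zpow (odd_two_mul_add_one j)]
      split_ifs with hj
      · rw [abs_of_nonneg (by omega : 0 ≤ 2 * j + 1), abs_of_nonneg (by omega : 0 ≤ j),
          abs_of_nonneg (by omega : 0 ≤ j + 1),
          show 1 - (2 * j + 1) = 2 * -j by ring, sqrt_two_zpow_two_mul,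
          show -(2 * j + 1) = -j + -j + -1 by ring, show -(j + 1) = -j + -1 by ring,
          zpow_add₀ two_ne_zero, zpow_add₀ two_ne_zero, zpow_add₀ two_ne_zero]
        field_simp
        norm_num
      · rw [abs_of_neg (by omega : 2 * j + 1 < 0), abs_of_neg (by omega : j < 0),
          abs_of_nonpos (by omega : j + 1 ≤ 0),
          show 1 - -(2 * j + 1) = 2 * (j + 1) by ring, sqrt_two_zpow_two_mul,
          show - -(2 * j + 1) = j + j + 1 by ring, neg_neg, neg_neg,
          zpow_add_one₀ two_ne_zero, zpow_add₀ two_ne_zero, zpow_add_one₀ two_ne_zero]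
        field_simp
        norm_num
    · rw [poissonIntegral_odd, show 2 * j + 1 + 2 = 2 * (j + 1) + 1 by ring, poissonIntegral_odd,
        show 2 * j + 1 + 1 = 2 * (j + 1) by ring, (even_two_mul (j + 1)).neg_one_zpow]
      ring

/-! ### The Laplace transform as an exponential series of moments -/

lemma hasSum_exp_mul (t x : ℝ) :
    HasSum (fun k : ℕ => (k.factorial : ℝ)⁻¹ * (-t) ^ k * x ^ k) (Real.exp (-t * x)) := by
  have h := NormedSpace.exp_series_hasSum_exp' (𝕂 := ℝ) (-t * x)
  rw [← Real.exp_eq_exp_ℝ] at h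
  simpa only [smul_eq_mul, mul_pow, mul_assoc] using h

lemma hasSum_integral_exp_mul {φ g : ℝ → ℝ} (hφ : Continuous φ) (hg : Continuous g) (t a b : ℝ) :
    HasSum (fun k : ℕ => (k.factorial : ℝ)⁻¹ * (-t) ^ k * ∫ s in a..b, φ s ^ k * g s)
      (∫ s in a..b, Real.exp (-t * φ s) * g s) := by
  simp only [← intervalIntegral.integral_const_mul]
  have hb : ∀ s, HasSum (fun k : ℕ => (k.factorial : ℝ)⁻¹ * (- -|t|) ^ k * |φ s| ^ k * |g s|)
      (Real.exp (- -|t| * |φ s|) * |g s|) := fun s => (hasSum_exp_mul (-|t|) |φ s|).mul_right _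
  refine intervalIntegral.hasSum_integral_of_dominated_convergence
    (fun (k : ℕ) s => (k.factorial : ℝ)⁻¹ * (- -|t|) ^ k * |φ s| ^ k * |g s|)
    (fun k => (Continuous.aestronglyMeasurable (by fun_prop)))
    (fun k => Filter.Eventually.of_forall fun s _ => ?_)
    (Filter.Eventually.of_forall fun s _ => (hb s).summable) ?_
    (Filter.Eventually.of_forall fun s _ => ?_)
  · simp [mul_assoc]
  · simp only [fun s => (hb s).tsum_eq]
    exact Continuous.intervalIntegrable (by fun_prop) _ _
  · simpa only [mul_assoc] using (hasSum_exp_mul t (φ s)).mul_right (g s)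

lemma hasSum_moment (t : ℝ) (n : ℤ) :
    HasSum (fun k : ℕ => (k.factorial : ℝ)⁻¹ * (-t) ^ k * moment k n) (K t n) := by
  have hR := continuous_R
  have h := ((((hasSum_exp_mul t (3 / 4)).mul_right (alpha n)).add
    ((hasSum_exp_mul t (7 / 4)).mul_right (beta n))).add
    (hasSum_integral_exp_mul (φ := fun s => 7 / 8 - R s / 2) (by fun_prop)
      (continuous_gammaMinus n) t 0 Real.pi)).add
    (hasSum_integral_exp_mul (φ := fun s => 7 / 8 + R s / 2) (by fun_prop)
      (continuous_gammaPlus n) t 0 Real.pi)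
  have e : (fun k : ℕ => (k.factorial : ℝ)⁻¹ * (-t) ^ k * moment k n) = _ := funext fun k => by
    unfold moment
    rw [mul_add, mul_add, mul_add, ← mul_assoc, ← mul_assoc]
  rw [e]
  exact h

/-! ### The heat kernel and its convolution kernel -/

section Kernel

variable {G : Type*} [Group G] (a b : G)

lemma memLp_mul_left (g : G) (f : L2 G) : Memℓp (fun x => f (g * x)) 2 := by
  have h := lp.memℓp f
  rw [memℓp_gen_iff (by norm_num)] at h ⊢
  exact h.comp_injective (i := fun x => g * x) (mul_right_injective g)

/-- Left translation on `ℓ²(G)`, `(λ_g f)(x) = f(g⁻¹x)`. -/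
noncomputable def leftTranslation (g : G) : L2 G →L[ℂ] L2 G :=
  LinearMap.mkContinuous
    { toFun := fun f => ⟨fun x => f (g⁻¹ * x), memLp_mul_left g⁻¹ f⟩
      map_add' := fun f₁ f₂ => by ext x; rfl
      map_smul' := fun c f => by ext x; rfl } 1 (fun f => by
      have hp : 0 < (2 : ℝ≥0∞).toReal := by norm_num
      rw [one_mul, lp.norm_eq_tsum_rpow hp, lp.norm_eq_tsum_rpow hp]
      refine le_of_eq (congrArg (fun r : ℝ => r ^ (1 / (2 : ℝ≥0∞).toReal)) ?_)
      exact (Equiv.mulLeft g⁻¹).tsum_eq (fun x => ‖f x‖ ^ (2 : ℝ≥0∞).toReal))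

lemma leftTranslation_apply (g : G) (f : L2 G) (x : G) :
    leftTranslation g f x = f (g⁻¹ * x) := rfl

lemma commute_leftTranslation_laplacian (g : G) :
    Commute (leftTranslation g) (laplacian a b) := by
  refine ContinuousLinearMap.ext fun f => ?_
  ext x
  change leftTranslation g (laplacian a b f) x = laplacian a b (leftTranslation g f) x
  simp only [laplacian_apply, leftTranslation_apply, mul_assoc]

lemma commute_leftTranslation_heatKernel (g : G) (t : ℝ) :
    Commute (leftTranslation g) (heatKernel a b t) :=
  ((commute_leftTranslation_laplacian a b g).smul_right _).exp_right

open Classical in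
/-- The unit mass at `1`. -/
noncomputable def delta (G : Type*) [Group G] : L2 G := lp.single 2 1 1

open Classical in
lemma delta_apply (x : G) : delta G x = if x = 1 then 1 else 0 := by
  rw [delta, lp.single_apply]
  by_cases h : x = 1
  · subst h
    simp
  · simp [h]

open Classical in
lemma leftTranslation_delta (g : G) : leftTranslation g (delta G) = lp.single 2 g 1 := by
  ext x
  rw [leftTranslation_apply, delta_apply, lp.single_apply]
  by_cases h : x = g
  · subst h
    simp
  · have h' : ¬ g⁻¹ * x = 1 := fun h1 => h (by rw [← inv_mul_eq_one.1 h1])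
    simp [h, h']

/-- The heat kernel commutes with left translations, hence acts by convolution with its value at the
unit mass. -/
lemma hasSum_heatKernel (t : ℝ) (f : L2 G) (x : G) :
    HasSum (fun y => heatKernel a b t (delta G) (y⁻¹ * x) * f y) (heatKernel a b t f x) := by
  classical
  have h := ((lp.evalCLM ℂ (fun _ : G => ℂ) 2 x).comp (heatKernel a b t)).hasSum
    (lp.hasSum_single (by norm_num) f)
  refine Eq.mpr (congrArg (fun F => HasSum F _) (funext fun y => ?_)) h
  have hy : lp.single 2 y (f y) = f y • leftTranslation y (delta G) := by
    rw [leftTranslation_delta, ← lp.single_smul, smul_eq_mul, mul_one]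
  have hc := DFunLike.congr_fun (commute_leftTranslation_heatKernel a b y t).eq (delta G)
  change leftTranslation y (heatKernel a b t (delta G))
    = heatKernel a b t (leftTranslation y (delta G)) at hc
  change _ = heatKernel a b t (lp.single 2 y (f y)) x
  rw [hy, map_smul, ← hc, lp.coeFn_smul, Pi.smul_apply, leftTranslation_apply, smul_eq_mul,
    mul_comm]

/-- A function represents the heat kernel by convolution iff it is the value at the unit mass. -/
lemma hasSum_heatKernel_iff (t : ℝ) (k : G → ℝ) :
    (∀ (f : L2 G) (x : G), HasSum (fun y => (k (y⁻¹ * x) : ℂ) * f y) (heatKernel a b t f x)) ↔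
      ∀ x, (k x : ℂ) = heatKernel a b t (delta G) x := by
  constructor
  · intro h x
    refine HasSum.unique ?_ (h (delta G) x)
    convert hasSum_single (1 : G) fun y hy => ?_ using 1
    · simp [delta_apply]
    · simp [delta_apply, hy]
  · intro h f x
    simpa only [h] using hasSum_heatKernel a b t f x

/-- The exponential series of the heat kernel. -/
lemma hasSum_heatKernel_apply (t : ℝ) (f : L2 G) (x : G) :
    HasSum (fun k : ℕ => (k.factorial : ℂ)⁻¹ * (-t : ℂ) ^ k * ((laplacian a b ^ k) f x))
      (heatKernel a b t f x) := by
  have h := ((lp.evalCLM ℂ (fun _ : G => ℂ) 2 x).comp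
    (ContinuousLinearMap.apply ℂ (L2 G) f)).hasSum
    (NormedSpace.exp_series_hasSum_exp' (𝕂 := ℂ) ((-t : ℂ) • laplacian a b))
  refine Eq.mpr (congrArg (fun F => HasSum F _) (funext fun k => ?_)) h
  rw [smul_pow, smul_smul]
  rfl

variable {a b}

/-- The powers of the Laplacian at the unit mass are the moments of the spectral measures. -/
lemma laplacian_pow_delta (ha : a ^ 2 = 1) (hb : b ^ 3 = 1)
    (hfree : ∀ w, IsReduced w → wordVal a b w = 1 → w = []) (hsurj : ∀ x, ∃ w, wordVal a b w = x)
    (k : ℕ) (x : G) : (laplacian a b ^ k) (delta G) x = (moment k (proj a b x) : ℂ) := by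
  induction k generalizing x with
  | zero =>
    rw [moment_zero, pow_zero]
    change delta G x = _
    rw [delta_apply]
    by_cases hx : x = 1
    · simp [hx, (proj_eq_zero_iff ha hb hfree hsurj 1).2 rfl]
    · simp [hx, mt (proj_eq_zero_iff ha hb hfree hsurj x).1 hx]
  | succ k ih =>
    rw [pow_succ']
    change laplacian a b ((laplacian a b ^ k) (delta G)) x = _
    rw [laplacian_apply, ih, ih, ih, ih, ← intLaplacian_moment,
      ← intLaplacian_proj ha hb hfree hsurj]
    push_cast
    ring

lemma heatKernel_delta (ha : a ^ 2 = 1) (hb : b ^ 3 = 1)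
    (hfree : ∀ w, IsReduced w → wordVal a b w = 1 → w = []) (hsurj : ∀ x, ∃ w, wordVal a b w = x)
    (t : ℝ) (x : G) : heatKernel a b t (delta G) x = (K t (proj a b x) : ℂ) := by
  refine (hasSum_heatKernel_apply a b t (delta G) x).unique ?_
  simp only [laplacian_pow_delta ha hb hfree hsurj]
  simpa using Complex.hasSum_ofReal.2 (hasSum_moment t (proj a b x))

end Kernel

end PSLHeat

theorem theorem1 :
    Function.Bijective PSLHeat.presentationHom ∧
    ∀ (t : ℝ), 0 ≤ t → ∀ (k : PSL(2, ℤ) → ℝ),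
      (∀ (f : PSLHeat.L2 PSL(2, ℤ)) (x : PSL(2, ℤ)),
          HasSum (fun y : PSL(2, ℤ) => (k (y⁻¹ * x) : ℂ) * f y)
            (PSLHeat.heatKernel PSLHeat.genA PSLHeat.genB t f x)) ↔
        (∀ x : PSL(2, ℤ), k x = PSLHeat.K t (PSLHeat.proj PSLHeat.genA PSLHeat.genB x)) := by
  refine ⟨PSLHeat.presentationHom_bijective, fun t _ k => ?_⟩
  rw [PSLHeat.hasSum_heatKernel_iff]
  refine forall_congr' fun x => ?_
  rw [PSLHeat.heatKernel_delta PSLHeat.genA_sq PSLHeat.genB_cube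
    (fun _ => PSLHeat.eq_nil_of_wordVal_genA_genB) PSLHeat.exists_wordVal_genA_genB,
    Complex.ofReal_inj]
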